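/- **Theorem (Approximation guarantee).** Let $k$ be a positive semidefinite kernel on a set $\mathbb X$, let $x_1,\dots,x_n\in\mathbb X$, $\mathbf y\in\mathbb R^n$, $\sigma\in\mathbb R$, and $\mathbf K_0 = k(\mathbf X,\mathbf X)+\sigma^2\mathbf I$, i.e. $[\mathbf K_0]_{ij}=k(x_i,x_j)+\sigma^2\delta_{ij}$. For data-point-specific noise variances $\boldsymbol\rho\in[0,\infty)^n$ let $\mathcal L(\boldsymbol\rho)$ be the log marginal likelihood, $$-2\mathcal L(\boldsymbol\rho)=\mathbf y^\top(\mathbf K_0+\mathbf D_{\boldsymbol\rho})^{-1}\mathbf y+\log\det(\mathbf K_0+\mathbf D_{\boldsymbol\rho})+n\log 2\pi ,$$ where $\mathbf D_{\boldsymbol\rho}$ is the diagonal matrix with diagonal $\boldsymbol\rho$. For $\mathbf s\in[0,1)^n$ put $\rho_i(\mathbf s)=[\mathbf K_0]_{ii}\,((1-s_i)^{-1}-1)$, and let $\tilde{\mathcal L}(\boldsymbol\rho)=\mathcal L(\boldsymbol\rho)-\mathcal L(\mathbf 0)$. Let $m>0$, $0<s_{\max}<1$ and $M>1/(1-s_{\max})^2$.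 Suppose that $\mathbf K_0$ is $\delta$-diagonally dominant, i.e. $\sum_{j\ne i}|[\mathbf K_0]_{ij}|<\delta\,|[\mathbf K_0]_{ii}|$ for all $i$, that $$\delta<\tfrac14\Bigl((5-m)-\sqrt{(5-m)^2-8(1-m)}\Bigr),$$ and that $$\|\mathbf y\|_2^2\le\lambda_{\min}(\mathbf K_0)(1-\delta)^2\,\frac{2(1+\delta)^{-1}-(1-\delta)^{-2}-m}{2\bigl(1-\frac{1-\delta}{1+\delta}\bigr)},\qquad \|\mathbf y\|_2^2\le\lambda_{\min}(\mathbf K_0)(1-\delta)^2\,\frac{M(1-s_{\max})^2-1}{2\bigl(\frac{1+\delta}{1-\delta}-1\bigr)} .$$ Let $r\ge 0$ with $2r\le n$. All vectors $\mathbf s$ are constrained to $[0,s_{\max}]^n$. Let $\mathbf s_{\mathrm{OMP}}(r)$ be any result of $r$ steps of orthogonal matching pursuit (OMP) for maximizing $F(\mathbf s)=\mathcal L(\boldsymbol\rho(\mathbf s))$: start with $S_0=\emptyset$ and $\mathbf s^{(0)}=\mathbf 0$; in step $i$ choose $j\notin S_i$ that maximizes the magnitude of the component $j$ of the gradient of $F$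 at $\mathbf s^{(i)}$, projected onto the constraint $s_j\ge 0$, which is $\max(\partial_jF(\mathbf s^{(i)}),0)$ because $s^{(i)}_j=0$ (ties are broken arbitrarily); put $S_{i+1}=S_i\cup\{j\}$ and let $\mathbf s^{(i+1)}$ be a maximizer of $F$ over the vectors in $[0,s_{\max}]^n$ supported in $S_{i+1}$. Let $\mathbf s_{\mathrm{OPT}}(r)$ be any maximizer of $F$ over the vectors in $[0,s_{\max}]^n$ with at most $r$ nonzero entries. Such $\mathbf s_{\mathrm{OMP}}(r)$ and $\mathbf s_{\mathrm{OPT}}(r)$ exist, and $$\tilde{\mathcal L}\bigl(\boldsymbol\rho(\mathbf s_{\mathrm{OMP}}(r))\bigr)\ \ge\ \bigl(1-e^{-m/M}\bigr)\,\tilde{\mathcal L}\bigl(\boldsymbol\rho(\mathbf s_{\mathrm{OPT}}(r))\bigr).$$ Moreover, for every $S\subseteq\{1,\dots,n\}$, $\tilde{\mathcal L}(\boldsymbol\rho(\mathbf s))\ge 0$ at every maximizer $\mathbf s$ of $F$ over the vectors in $[0,s_{\max}]^n$ supported in $S$. -/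

import Mathlib

open scoped Matrix

namespace RobustGP

/-- A (covariance) kernel on `X`: symmetric, and every finite Gram matrix is positive semidefinite. -/
def IsPSDKernel {X : Type*} (k : X → X → ℝ) : Prop :=
  ∀ (N : ℕ) (x : Fin N → X), (Matrix.of fun i j => k (x i) (x j)).PosSemidef

/-- The base covariance matrix `K₀ = k(X, X) + σ² I` of the data points `x`. -/
def baseCov {X : Type*} {n : ℕ} (k : X → X → ℝ) (σ : ℝ) (x : Fin n → X) :
    Matrix (Fin n) (Fin n) ℝ :=
  (Matrix.of fun i j => k (x i) (x j)) + σ ^ 2 • (1 : Matrix (Fin n) (Fin n) ℝ)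

/-- `A` is `δ`-diagonally dominant. -/
def DiagDominant {n : ℕ} (δ : ℝ) (A : Matrix (Fin n) (Fin n) ℝ) : Prop :=
  ∀ i, ∑ j ∈ Finset.univ.erase i, |A i j| < δ * |A i i|

/-- The smallest eigenvalue of a (real symmetric) matrix. -/
noncomputable def minEigenvalue {n : ℕ} (A : Matrix (Fin n) (Fin n) ℝ) : ℝ :=
  sInf (spectrum ℝ A)

/-- The log marginal likelihood of the observations `y` at the data-point-specific noise variances
`ρ`, i.e. the log density at `y` of the centred Gaussian with covariance `K₀ + diag ρ`:
`-2 L(ρ) = yᵀ (K₀ + D_ρ)⁻¹ y + log det (K₀ + D_ρ) + n log 2π`. -/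
noncomputable def logML {n : ℕ} (K₀ : Matrix (Fin n) (Fin n) ℝ) (y : EuclideanSpace ℝ (Fin n))
    (ρ : Fin n → ℝ) : ℝ :=
  -(1 / 2) * ((fun i => y i) ⬝ᵥ ((K₀ + Matrix.diagonal ρ)⁻¹ *ᵥ fun i => y i)
    + Real.log (K₀ + Matrix.diagonal ρ).det + n * Real.log (2 * Real.pi))

/-- The convex parameterization `ρ(s) = diag(K₀) ⊙ ((1 - s)⁻¹ - 1)`. -/
noncomputable def rhoOf {n : ℕ} (K₀ : Matrix (Fin n) (Fin n) ℝ) (s : Fin n → ℝ) : Fin n → ℝ :=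
  fun i => K₀ i i * ((1 - s i)⁻¹ - 1)

/-- The feasible vectors `s`: entrywise nonnegative with `‖s‖_∞ ≤ smax`
(the norm of `Fin n → ℝ` is the sup norm). -/
def feasible (n : ℕ) (smax : ℝ) : Set (Fin n → ℝ) :=
  {s | 0 ≤ s ∧ ‖s‖ ≤ smax}

/-- The number `‖s‖₀` of nonzero entries of `s`. -/
noncomputable def numNonzero {n : ℕ} (s : Fin n → ℝ) : ℕ :=
  {i | s i ≠ 0}.ncard

/-- `s` maximizes `F` over the vectors of `D` that vanish outside of the support set `S`. -/
def IsSupportMax {n : ℕ} (F : (Fin n → ℝ) → ℝ) (D : Set (Fin n → ℝ)) (S : Finset (Fin n))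
    (s : Fin n → ℝ) : Prop :=
  (s ∈ D ∧ ∀ i ∉ S, s i = 0) ∧ ∀ t ∈ D, (∀ i ∉ S, t i = 0) → F t ≤ F s

/-- `s` maximizes `F` over the `r`-sparse vectors of `D`. -/
def IsSparseMax {n : ℕ} (F : (Fin n → ℝ) → ℝ) (D : Set (Fin n → ℝ)) (r : ℕ)
    (s : Fin n → ℝ) : Prop :=
  (s ∈ D ∧ numNonzero s ≤ r) ∧ ∀ t ∈ D, numNonzero t ≤ r → F t ≤ F s

/-- The size of the `j`-th component of the gradient of `F` at `s`, where `s j = 0` lies on the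
boundary of the constraint `s j ≥ 0`: the part of the gradient that points out of the constraint set
is projected away, which leaves the positive part of the partial derivative. -/
noncomputable def gradSize {n : ℕ} (F : (Fin n → ℝ) → ℝ) (s : Fin n → ℝ) (j : Fin n) : ℝ :=
  max (fderiv ℝ F s (Pi.single j 1)) 0

/-- `OMP F D i S s`: after `i` steps, orthogonal matching pursuit for the maximization of `F`
over `D` (a set of nonnegative vectors) can have the support `S` and the iterate `s`. Each step adds
one index outside of the support at which the (projected) gradient is largest, ties being broken
arbitrarily, and then optimizes fully over the new support. -/
inductive OMP {n : ℕ} (F : (Fin n → ℝ) → ℝ) (D : Set (Fin n → ℝ)) :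
    ℕ → Finset (Fin n) → (Fin n → ℝ) → Prop
  | init (s : Fin n → ℝ) (hs : IsSupportMax F D ∅ s) : OMP F D 0 ∅ s
  | step (i : ℕ) (S : Finset (Fin n)) (s : Fin n → ℝ) (j : Fin n) (s' : Fin n → ℝ)
      (h : OMP F D i S s) (hj : j ∉ S) (hmax : ∀ j' ∉ S, gradSize F s j' ≤ gradSize F s j)
      (hs' : IsSupportMax F D (insert j S) s') : OMP F D (i + 1) (insert j S) s'

end RobustGP

/-!
Write `K` for the covariance `K₀ + diag ρ(s)`, `D` for its diagonal, and `α = K⁻¹ y`. Diagonal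
dominance survives the addition of a nonnegative diagonal, so in the Loewner order
`(1 - δ) D ≤ K ≤ (1 + δ) D` at every feasible `s` (`DiagDominant.nearDiagonal`). Hence
`D⁻¹ / (1 + δ) ≤ K⁻¹ ≤ D⁻¹ / (1 - δ)`, and `∑ D i * (α i) ^ 2 ≤ ‖y‖² / (λ_min (1 - δ)²)`.

The parameterization is chosen such that, along a line with direction `Δ` in the parameters `s`, the
diagonal of `K` has velocity `D u` and acceleration `2 D u²`, where `u = Δ / (1 - s)`. The second
derivative of `-2 L` along this line is therefore
`2 ∑ i, K⁻¹ i i * D i * (u i) ^ 2 - ∑ i j, (K⁻¹ i j) ^ 2 * (D i * u i) * (D j * u j)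
  - 2 ∑ i, D i * (α i) ^ 2 * (u i) ^ 2 + 2 (D u α)ᵀ K⁻¹ (D u α)`.
The bounds on `K⁻¹` and `α` show that it is at least `m ‖Δ‖₂²` (`NearDiagonal.secondVar_lower`) and,
if `Δ` is a multiple of a coordinate vector, at most `M ‖Δ‖₂²` (`NearDiagonal.secondVar_upper`).

Only these two facts enter the analysis of OMP. By strong concavity and the first-order condition on
the current support, the gap to an `r`-sparse vector `t` is at most a sum of at most `r` terms
`g * t i - (m / 4) * (t i) ^ 2`, where `g` is the largest projected partial derivative. By smoothness,
the move by `(m / M) * t i` along the selected coordinate gains the fraction `m / M` of such a term,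
and it stays in the box because `m ≤ M`. So every step closes the fraction `m / (M r)` of the gap
(`gap_le_mul_gain`), and `(1 - m / (M r)) ^ r ≤ exp (-(m / M))`.
-/

namespace RobustGP

/-! ### Calculus of determinants and inverses of matrices -/

section MatrixCalculus
open scoped Matrix.Norms.Operator

variable {n : ℕ}

lemma differentiable_det :
    Differentiable ℝ fun A : Matrix (Fin n) (Fin n) ℝ => A.det := by
  have hentry : ∀ i j, Differentiable ℝ fun A : Matrix (Fin n) (Fin n) ℝ => A i j := fun i j =>
    (LinearMap.toContinuousLinearMap (Matrix.entryLinearMap ℝ ℝ i j)).differentiable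
  simp only [Matrix.det_apply']
  fun_prop

lemma fderiv_det_apply (A : Matrix (Fin n) (Fin n) ℝ) (hA : A.det ≠ 0)
    (H : Matrix (Fin n) (Fin n) ℝ) :
    fderiv ℝ (fun B : Matrix (Fin n) (Fin n) ℝ => B.det) A H = A.det * (A⁻¹ * H).trace := by
  have h1 : HasDerivAt (fun τ : ℝ => A + τ • H) H 0 := by
    have := ((hasDerivAt_id (0 : ℝ)).smul_const H).const_add A
    rw [one_smul] at this
    exact this
  have h2 : HasDerivAt (fun τ : ℝ => (A + τ • H).det)
      (fderiv ℝ (fun B : Matrix (Fin n) (Fin n) ℝ => B.det) (A + (0 : ℝ) • H) H) 0 :=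
    (differentiable_det (n := n) (A + (0 : ℝ) • H)).hasFDerivAt.comp_hasDerivAt (0 : ℝ) h1
  rw [zero_smul, add_zero] at h2
  -- `det (1 + τ • (A⁻¹ * H))` is a polynomial in `τ` with linear coefficient `tr (A⁻¹ * H)`
  obtain ⟨p, hp⟩ : ∃ p : Polynomial ℝ, ∀ τ : ℝ, (A + τ • H).det =
      A.det * (1 + (A⁻¹ * H).trace * τ + p.eval τ * τ ^ 2) := by
    refine ⟨(Matrix.det (1 + (Polynomial.X : Polynomial ℝ) •
      (A⁻¹ * H).map Polynomial.C)).divX.divX, fun τ => ?_⟩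
    rw [← Matrix.det_one_add_smul, ← Matrix.det_mul, mul_add, mul_one, mul_smul_comm, ← mul_assoc,
      Matrix.mul_nonsing_inv A (isUnit_iff_ne_zero.2 hA), one_mul]
  have h3 : HasDerivAt (fun τ : ℝ => (A + τ • H).det) (A.det * (A⁻¹ * H).trace) 0 := by
    simp only [hp]
    have := ((((hasDerivAt_id (0 : ℝ)).const_mul (A⁻¹ * H).trace).const_add 1).add
      ((p.hasDerivAt 0).mul ((hasDerivAt_id (0 : ℝ)).pow 2))).const_mul A.det
    simpa using this
  exact h2.unique h3

/-- Jacobi's formula for the logarithm of the determinant along a path of matrices. -/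
lemma hasDerivAt_log_det {K : ℝ → Matrix (Fin n) (Fin n) ℝ} {K' : Matrix (Fin n) (Fin n) ℝ}
    {t : ℝ} (hK : HasDerivAt K K' t) (hdet : (K t).det ≠ 0) :
    HasDerivAt (fun τ => Real.log (K τ).det) ((K t)⁻¹ * K').trace t := by
  have h : HasDerivAt (fun τ => (K τ).det) ((K t).det * ((K t)⁻¹ * K').trace) t := by
    rw [← fderiv_det_apply _ hdet]
    exact (differentiable_det (n := n) (K t)).hasFDerivAt.comp_hasDerivAt t hK
  have h := h.log hdet
  rwa [mul_div_cancel_left₀ _ hdet] at h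

lemma hasDerivAt_matrix_inv {K : ℝ → Matrix (Fin n) (Fin n) ℝ} {K' : Matrix (Fin n) (Fin n) ℝ}
    {t : ℝ} (hK : HasDerivAt K K' t) (hdet : (K t).det ≠ 0) :
    HasDerivAt (fun τ => (K τ)⁻¹) (-((K t)⁻¹ * K' * (K t)⁻¹)) t := by
  obtain ⟨u, hu⟩ : IsUnit (K t) :=
    (Matrix.isUnit_iff_isUnit_det _).2 (isUnit_iff_ne_zero.2 hdet)
  have e : (↑u⁻¹ : Matrix (Fin n) (Fin n) ℝ) = (K t)⁻¹ := by rw [← hu, Matrix.coe_units_inv]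
  have h := hasFDerivAt_ringInverse (𝕜 := ℝ) u
  rw [hu, e] at h
  have h := h.comp_hasDerivAt t hK
  simp only [Matrix.nonsing_inv_eq_ringInverse] at h ⊢
  exact h

lemma hasDerivAt_inv_entry {K : ℝ → Matrix (Fin n) (Fin n) ℝ} {K' : Matrix (Fin n) (Fin n) ℝ}
    {t : ℝ} (hK : HasDerivAt K K' t) (hdet : (K t).det ≠ 0) (i j : Fin n) :
    HasDerivAt (fun τ => (K τ)⁻¹ i j) (-((K t)⁻¹ * K' * (K t)⁻¹) i j) t :=
  (LinearMap.toContinuousLinearMap (Matrix.entryLinearMap ℝ ℝ i j)).hasFDerivAt.comp_hasDerivAt t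
    (hasDerivAt_matrix_inv hK hdet)

lemma differentiableAt_add_diagonal {E : Type*} [NormedAddCommGroup E] [NormedSpace ℝ E]
    (K₀ : Matrix (Fin n) (Fin n) ℝ) {ρ : E → Fin n → ℝ} {x : E} (h : DifferentiableAt ℝ ρ x) :
    DifferentiableAt ℝ (fun z => K₀ + Matrix.diagonal (ρ z)) x :=
  ((LinearMap.toContinuousLinearMap
    (Matrix.diagonalLinearMap (Fin n) ℝ ℝ)).differentiableAt.comp x h).const_add K₀

lemma hasDerivAt_add_diagonal (K₀ : Matrix (Fin n) (Fin n) ℝ) {ρ : ℝ → Fin n → ℝ}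
    {ρ' : Fin n → ℝ} {t : ℝ} (h : HasDerivAt ρ ρ' t) :
    HasDerivAt (fun τ => K₀ + Matrix.diagonal (ρ τ)) (Matrix.diagonal ρ') t :=
  ((LinearMap.toContinuousLinearMap
    (Matrix.diagonalLinearMap (Fin n) ℝ ℝ)).hasFDerivAt.comp_hasDerivAt t h).const_add K₀

lemma differentiableAt_inv_entry {A : Matrix (Fin n) (Fin n) ℝ} (hA : A.det ≠ 0) (i j : Fin n) :
    DifferentiableAt ℝ (fun B : Matrix (Fin n) (Fin n) ℝ => B⁻¹ i j) A := by
  have h : DifferentiableAt ℝ (fun B : Matrix (Fin n) (Fin n) ℝ => B⁻¹) A := by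
    simp only [Matrix.nonsing_inv_eq_ringInverse]
    exact differentiableAt_inverse ((Matrix.isUnit_iff_isUnit_det _).2 (isUnit_iff_ne_zero.2 hA))
  exact DifferentiableAt.comp (f := fun B : Matrix (Fin n) (Fin n) ℝ => B⁻¹) A
    (LinearMap.toContinuousLinearMap (Matrix.entryLinearMap ℝ ℝ i j)).differentiableAt h

lemma differentiableAt_logML {E : Type*} [NormedAddCommGroup E] [NormedSpace ℝ E]
    (K₀ : Matrix (Fin n) (Fin n) ℝ) (y : EuclideanSpace ℝ (Fin n)) {ρ : E → Fin n → ℝ} {x : E}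
    (h : DifferentiableAt ℝ ρ x) (hdet : (K₀ + Matrix.diagonal (ρ x)).det ≠ 0) :
    DifferentiableAt ℝ (fun z => logML K₀ y (ρ z)) x := by
  have hK := differentiableAt_add_diagonal K₀ h
  have hd : DifferentiableAt ℝ (fun z => (K₀ + Matrix.diagonal (ρ z)).det) x :=
    (differentiable_det (n := n) _).comp x hK
  have he : ∀ i j, DifferentiableAt ℝ (fun z => (K₀ + Matrix.diagonal (ρ z))⁻¹ i j) x :=
    fun i j => DifferentiableAt.comp (f := fun z => K₀ + Matrix.diagonal (ρ z))
      (g := fun B : Matrix (Fin n) (Fin n) ℝ => B⁻¹ i j) x (differentiableAt_inv_entry hdet i j) hK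
  have hq : DifferentiableAt ℝ (fun z => (fun i => y i) ⬝ᵥ
      ((K₀ + Matrix.diagonal (ρ z))⁻¹ *ᵥ fun i => y i)) x := by
    simp only [dotProduct, Matrix.mulVec]
    exact DifferentiableAt.fun_sum fun i _ =>
      (DifferentiableAt.fun_sum fun j _ => (he i j).mul_const _).const_mul _
  unfold logML
  exact ((hq.add (hd.log hdet)).add_const _).const_mul _

end MatrixCalculus

/-! ### Derivatives of the log marginal likelihood along a path of noise variances -/

section Variations

variable {n : ℕ}

/-- The first derivative of `-2 L` when the diagonal of the covariance moves with velocity `p`;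
`N` is the inverse covariance. -/
def firstVar (N : Matrix (Fin n) (Fin n) ℝ) (y p : Fin n → ℝ) : ℝ :=
  ∑ i, p i * (N i i - (N *ᵥ y) i ^ 2)

/-- The second derivative of `-2 L` when the diagonal of the covariance moves with velocity `p` and
acceleration `q`; `N` is the inverse covariance. -/
def secondVar (N : Matrix (Fin n) (Fin n) ℝ) (y p q : Fin n → ℝ) : ℝ :=
  ∑ i, (q i * (N i i - (N *ᵥ y) i ^ 2) +
    p i * (-(∑ j, N i j ^ 2 * p j) + 2 * (N *ᵥ y) i * ∑ j, N i j * (p j * (N *ᵥ y) j)))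

lemma inv_mul_diagonal_mul_inv_entry {N : Matrix (Fin n) (Fin n) ℝ} (p : Fin n → ℝ) (i j : Fin n) :
    (N * Matrix.diagonal p * N) i j = ∑ k, N i k * p k * N k j := by
  rw [Matrix.mul_apply]
  simp only [Matrix.mul_diagonal]

lemma sum_neg_inv_mul_diagonal_mul_inv (N : Matrix (Fin n) (Fin n) ℝ) (p y : Fin n → ℝ)
    (i : Fin n) :
    ∑ j, -(N * Matrix.diagonal p * N) i j * y j = -∑ k, N i k * (p k * (N *ᵥ y) k) := by
  simp only [inv_mul_diagonal_mul_inv_entry, neg_mul, Finset.sum_neg_distrib, neg_inj,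
    Matrix.mulVec, dotProduct, Finset.sum_mul, Finset.mul_sum]
  rw [Finset.sum_comm]
  exact Finset.sum_congr rfl fun j _ => Finset.sum_congr rfl fun k _ => by ring

lemma hasDerivAt_neg_two_logML (K₀ : Matrix (Fin n) (Fin n) ℝ) (y : EuclideanSpace ℝ (Fin n))
    {ρ : ℝ → Fin n → ℝ} {p : Fin n → ℝ} {t : ℝ} (hρ : HasDerivAt ρ p t)
    (hdet : (K₀ + Matrix.diagonal (ρ t)).det ≠ 0)
    (hsymm : ∀ i j, (K₀ + Matrix.diagonal (ρ t))⁻¹ i j = (K₀ + Matrix.diagonal (ρ t))⁻¹ j i) :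
    HasDerivAt (fun τ => -2 * logML K₀ y (ρ τ))
      (firstVar (K₀ + Matrix.diagonal (ρ t))⁻¹ (fun i => y i) p) t := by
  have hK := hasDerivAt_add_diagonal K₀ hρ
  have hN := hasDerivAt_inv_entry hK hdet
  have hq : HasDerivAt (fun τ => ∑ i, y i * ∑ j, (K₀ + Matrix.diagonal (ρ τ))⁻¹ i j * y j) _ t :=
    HasDerivAt.fun_sum fun i _ => (HasDerivAt.fun_sum fun j _ =>
      (hN i j).mul_const (y j)).const_mul (y i)
  have h := (hq.add (hasDerivAt_log_det hK hdet)).add_const (n * Real.log (2 * Real.pi))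
  refine (h.congr_deriv ?_).congr_of_eventuallyEq (Filter.Eventually.of_forall fun τ => ?_)
  · set N := (K₀ + Matrix.diagonal (ρ t))⁻¹ with hNdef
    have e1 : (N * Matrix.diagonal p).trace = ∑ i, p i * N i i := by
      simp [Matrix.trace, mul_comm]
    have e2 : ∑ i, y i * ∑ j, -(N * Matrix.diagonal p * N) i j * y j =
        -∑ k, p k * (N *ᵥ fun i => y i) k ^ 2 := by
      simp only [sum_neg_inv_mul_diagonal_mul_inv, mul_neg, Finset.sum_neg_distrib, neg_inj,
        Finset.mul_sum]
      rw [Finset.sum_comm]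
      refine Finset.sum_congr rfl fun k _ => ?_
      calc _ = ∑ i, (p k * (N *ᵥ fun i => y i) k) * (N k i * y i) :=
            Finset.sum_congr rfl fun i _ => by rw [hsymm i k]; ring
        _ = _ := by rw [← Finset.mul_sum, sq, ← mul_assoc]; rfl
    rw [e1, e2, firstVar]
    simp only [mul_sub, Finset.sum_sub_distrib]
    ring
  · simp only [logML, dotProduct, Matrix.mulVec]
    simp only [Pi.add_apply]
    ring

lemma hasDerivAt_firstVar (K₀ : Matrix (Fin n) (Fin n) ℝ) (y : Fin n → ℝ)
    {ρ p : ℝ → Fin n → ℝ} {q : Fin n → ℝ} {t : ℝ} (hρ : HasDerivAt ρ (p t) t)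
    (hp : HasDerivAt p q t) (hdet : (K₀ + Matrix.diagonal (ρ t)).det ≠ 0)
    (hsymm : ∀ i j, (K₀ + Matrix.diagonal (ρ t))⁻¹ i j = (K₀ + Matrix.diagonal (ρ t))⁻¹ j i) :
    HasDerivAt (fun τ => firstVar (K₀ + Matrix.diagonal (ρ τ))⁻¹ y (p τ))
      (secondVar (K₀ + Matrix.diagonal (ρ t))⁻¹ y (p t) q) t := by
  have hN := hasDerivAt_inv_entry (hasDerivAt_add_diagonal K₀ hρ) hdet
  have hp' := hasDerivAt_pi.1 hp
  have hα : ∀ i, HasDerivAt (fun τ => ((K₀ + Matrix.diagonal (ρ τ))⁻¹ *ᵥ y) i)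
      (∑ j, -((K₀ + Matrix.diagonal (ρ t))⁻¹ * Matrix.diagonal (p t) *
        (K₀ + Matrix.diagonal (ρ t))⁻¹) i j * y j) t := fun i => by
    simp only [Matrix.mulVec, dotProduct]
    exact HasDerivAt.fun_sum fun j _ => (hN i j).mul_const (y j)
  unfold firstVar
  refine (HasDerivAt.fun_sum fun i _ => (hp' i).mul ((hN i i).sub ((hα i).pow 2))).congr_deriv ?_
  unfold secondVar
  refine Finset.sum_congr rfl fun i _ => ?_
  set N := (K₀ + Matrix.diagonal (ρ t))⁻¹ with hNdef
  have e1 : (N * Matrix.diagonal (p t) * N) i i = ∑ j, N i j ^ 2 * p t j := by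
    rw [inv_mul_diagonal_mul_inv_entry]
    exact Finset.sum_congr rfl fun j _ => by rw [hsymm j i]; ring
  rw [e1, sum_neg_inv_mul_diagonal_mul_inv]
  simp only [Pi.sub_apply, Pi.pow_apply]
  ring

/-! ### Inverses of matrices close to their diagonal -/

/-- `A` lies between `(1 - δ) D` and `(1 + δ) D` in the Loewner order, where `D` is the positive
diagonal matrix with diagonal `d`. -/
structure NearDiagonal (δ : ℝ) (d : Fin n → ℝ) (A : Matrix (Fin n) (Fin n) ℝ) : Prop where
  nonneg : 0 ≤ δ
  lt_one : δ < 1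
  pos : ∀ i, 0 < d i
  symm : ∀ i j, A i j = A j i
  lower : ∀ x : Fin n → ℝ, (1 - δ) * ∑ i, d i * x i ^ 2 ≤ x ⬝ᵥ A *ᵥ x
  upper : ∀ x : Fin n → ℝ, x ⬝ᵥ A *ᵥ x ≤ (1 + δ) * ∑ i, d i * x i ^ 2

namespace NearDiagonal

variable {δ : ℝ} {d : Fin n → ℝ} {A : Matrix (Fin n) (Fin n) ℝ} (h : NearDiagonal δ d A)
include h

lemma posDef : A.PosDef := by
  refine Matrix.PosDef.of_dotProduct_mulVec_pos (by ext i j; simp [h.symm i j]) fun x hx => ?_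
  refine lt_of_lt_of_le (mul_pos (sub_pos.2 h.lt_one) ?_) (h.lower x)
  obtain ⟨i, hi⟩ := Function.ne_iff.1 hx
  exact Finset.sum_pos' (fun j _ => mul_nonneg (h.pos j).le (sq_nonneg _))
    ⟨i, Finset.mem_univ i, mul_pos (h.pos i) (by simpa using pow_pos (abs_pos.2 hi) 2)⟩

lemma det_ne_zero : A.det ≠ 0 := h.posDef.det_pos.ne'

lemma inv_symm (i j : Fin n) : A⁻¹ i j = A⁻¹ j i := by
  have : A⁻¹ᵀ = A⁻¹ := by
    rw [Matrix.transpose_nonsing_inv]; congr 1; ext i j; exact h.symm j i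
  exact congrFun (congrFun this j) i

lemma mulVec_inv_mulVec (x : Fin n → ℝ) : A *ᵥ (A⁻¹ *ᵥ x) = x := by
  rw [Matrix.mulVec_mulVec, Matrix.mul_nonsing_inv _ (isUnit_iff_ne_zero.2 h.det_ne_zero),
    Matrix.one_mulVec]

lemma dotProduct_mulVec_comm (x z : Fin n → ℝ) : x ⬝ᵥ A *ᵥ z = z ⬝ᵥ A *ᵥ x := by
  rw [Matrix.dotProduct_mulVec, ← Matrix.mulVec_transpose, dotProduct_comm]
  congr 2; ext i j; exact h.symm j i

/-- Completing the square: `xᵀ A⁻¹ x` is the maximum of `2 wᵀ x - wᵀ A w` over `w`. -/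
lemma le_inv_quadratic (x w : Fin n → ℝ) :
    2 * (w ⬝ᵥ x) - w ⬝ᵥ A *ᵥ w ≤ x ⬝ᵥ A⁻¹ *ᵥ x := by
  have h0 := h.posDef.posSemidef.dotProduct_mulVec_nonneg (A⁻¹ *ᵥ x - w)
  simp only [star_trivial, Matrix.mulVec_sub, sub_dotProduct, dotProduct_sub,
    h.mulVec_inv_mulVec, h.dotProduct_mulVec_comm _ w] at h0
  rw [dotProduct_comm x]
  linarith

/-- The choice `w = (1 + δ)⁻¹ D⁻¹ x` in `le_inv_quadratic`. -/
lemma inv_quadratic_lower (x : Fin n → ℝ) :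
    (1 + δ)⁻¹ * ∑ i, x i ^ 2 / d i ≤ x ⬝ᵥ A⁻¹ *ᵥ x := by
  have hδ : 0 < 1 + δ := by linarith [h.nonneg]
  refine le_trans (le_of_eq ?_) (le_trans (sub_le_sub_left (h.upper _) _)
    (h.le_inv_quadratic x fun i => (1 + δ)⁻¹ * (x i / d i)))
  simp only [dotProduct, Finset.mul_sum, ← Finset.sum_sub_distrib]
  refine Finset.sum_congr rfl fun i _ => ?_
  have := (h.pos i).ne'
  field_simp
  ring

/-- The vector `A⁻¹ x` is controlled in the norm given by `D`. -/
lemma sum_mul_inv_mulVec_sq_le (x : Fin n → ℝ) :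
    ∑ i, d i * (A⁻¹ *ᵥ x) i ^ 2 ≤ ((1 - δ) ^ 2)⁻¹ * ∑ i, x i ^ 2 / d i := by
  have hδ : 0 < 1 - δ := by linarith [h.lt_one]
  have h1 := h.lower (A⁻¹ *ᵥ x)
  rw [h.mulVec_inv_mulVec] at h1
  have h2 : (A⁻¹ *ᵥ x) ⬝ᵥ x ≤ (1 - δ) / 2 * ∑ i, d i * (A⁻¹ *ᵥ x) i ^ 2 +
      (1 - δ)⁻¹ / 2 * ∑ i, x i ^ 2 / d i := by
    simp only [dotProduct, Finset.mul_sum, ← Finset.sum_add_distrib]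
    refine Finset.sum_le_sum fun i _ => ?_
    have hd := h.pos i
    have : 0 ≤ (1 - δ)⁻¹ / 2 * (((1 - δ) * (d i * (A⁻¹ *ᵥ x) i) - x i) ^ 2 / d i) := by positivity
    refine sub_nonneg.1 (this.trans_eq ?_)
    field_simp
    ring
  have h3 : (1 - δ) * ∑ i, d i * (A⁻¹ *ᵥ x) i ^ 2 ≤ (1 - δ)⁻¹ * ∑ i, x i ^ 2 / d i := by linarith
  have := mul_le_mul_of_nonneg_left h3 (inv_pos.2 hδ).le
  rw [← mul_assoc, inv_mul_cancel₀ hδ.ne', one_mul, ← mul_assoc] at this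
  rwa [← inv_pow, sq]

lemma inv_quadratic_upper (x : Fin n → ℝ) :
    x ⬝ᵥ A⁻¹ *ᵥ x ≤ (1 - δ)⁻¹ * ∑ i, x i ^ 2 / d i := by
  have hδ : 0 < 1 - δ := by linarith [h.lt_one]
  have h1 := h.lower (A⁻¹ *ᵥ x)
  rw [h.mulVec_inv_mulVec] at h1
  have h2 : 2 * ((A⁻¹ *ᵥ x) ⬝ᵥ x) ≤ (1 - δ) * ∑ i, d i * (A⁻¹ *ᵥ x) i ^ 2 +
      (1 - δ)⁻¹ * ∑ i, x i ^ 2 / d i := by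
    simp only [dotProduct, Finset.mul_sum, ← Finset.sum_add_distrib]
    refine Finset.sum_le_sum fun i _ => ?_
    have hd := h.pos i
    have : 0 ≤ (1 - δ)⁻¹ * (((1 - δ) * (d i * (A⁻¹ *ᵥ x) i) - x i) ^ 2 / d i) := by positivity
    refine sub_nonneg.1 (this.trans_eq ?_)
    field_simp
    ring
  rw [dotProduct_comm x]
  linarith

lemma sum_inv_entry_sq_mul_le (i : Fin n) :
    ∑ j, A⁻¹ i j ^ 2 * d j ≤ ((1 - δ) ^ 2)⁻¹ / d i := by
  have := h.sum_mul_inv_mulVec_sq_le (Pi.single i 1)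
  simp only [Matrix.mulVec_single_one, Matrix.col_apply, Pi.single_apply, ite_pow, one_pow,
    zero_pow two_ne_zero, ite_div, zero_div, Finset.sum_ite_eq', Finset.mem_univ, if_true,
    h.inv_symm _ i] at this
  calc _ = ∑ j, d j * A⁻¹ i j ^ 2 := Finset.sum_congr rfl fun j _ => mul_comm _ _
    _ ≤ _ := this.trans_eq (by ring)

lemma inv_diag_lower (i : Fin n) : (1 + δ)⁻¹ ≤ A⁻¹ i i * d i := by
  have := h.inv_quadratic_lower (Pi.single i 1)
  simp only [Matrix.mulVec_single_one, single_one_dotProduct, Matrix.col_apply, Pi.single_apply,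
    ite_pow, one_pow, zero_pow two_ne_zero, ite_div, zero_div, Finset.sum_ite_eq',
    Finset.mem_univ, if_true, mul_one_div] at this
  exact (div_le_iff₀ (h.pos i)).1 this

lemma inv_diag_upper (i : Fin n) : A⁻¹ i i * d i ≤ (1 - δ)⁻¹ := by
  have := h.inv_quadratic_upper (Pi.single i 1)
  simp only [Matrix.mulVec_single_one, single_one_dotProduct, Matrix.col_apply, Pi.single_apply,
    ite_pow, one_pow, zero_pow two_ne_zero, ite_div, zero_div, Finset.sum_ite_eq',
    Finset.mem_univ, if_true, mul_one_div] at this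
  exact (le_div_iff₀ (h.pos i)).1 this

/-- Strong convexity: the Hadamard square of `A⁻¹` is bounded by comparing `p i * p j` with squares
and using the row bound `sum_inv_entry_sq_mul_le`. -/
lemma secondVar_lower {y : Fin n → ℝ} {v m : ℝ}
    (hv : ∑ i, d i * (A⁻¹ *ᵥ y) i ^ 2 ≤ v)
    (hm : m ≤ 2 * (1 + δ)⁻¹ - ((1 - δ) ^ 2)⁻¹ - 2 * (1 - (1 + δ)⁻¹) * v) (u : Fin n → ℝ) :
    m * ∑ i, u i ^ 2 ≤
      secondVar A⁻¹ y (fun i => d i * u i) (fun i => 2 * (d i * u i ^ 2)) := by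
  set α := A⁻¹ *ᵥ y with hα
  have hδ := h.nonneg
  have e : secondVar A⁻¹ y (fun i => d i * u i) (fun i => 2 * (d i * u i ^ 2)) =
      ∑ i, 2 * (A⁻¹ i i * d i) * u i ^ 2 - ∑ i, 2 * (d i * α i ^ 2) * u i ^ 2
      - ∑ i, ∑ j, A⁻¹ i j ^ 2 * (d i * u i) * (d j * u j)
      + 2 * ((fun i => d i * u i * α i) ⬝ᵥ A⁻¹ *ᵥ fun i => d i * u i * α i) := by
    have e3 : ∀ i, ∑ j, A⁻¹ i j ^ 2 * (d i * u i) * (d j * u j) =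
        d i * u i * ∑ j, A⁻¹ i j ^ 2 * (d j * u j) := fun i => by
      rw [Finset.mul_sum]; exact Finset.sum_congr rfl fun j _ => by ring
    have e4 : (fun i => d i * u i * α i) ⬝ᵥ A⁻¹ *ᵥ (fun i => d i * u i * α i) =
        ∑ i, d i * u i * α i * ∑ j, A⁻¹ i j * (d j * u j * α j) := rfl
    rw [e4, Finset.mul_sum, ← Finset.sum_sub_distrib, ← Finset.sum_sub_distrib,
      ← Finset.sum_add_distrib, secondVar]
    refine Finset.sum_congr rfl fun i _ => ?_
    rw [e3]
    ring
  have hcoord : ∀ i, d i * α i ^ 2 ≤ v := fun i =>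
    (Finset.single_le_sum (f := fun i => d i * α i ^ 2)
      (fun j _ => mul_nonneg (h.pos j).le (sq_nonneg _)) (Finset.mem_univ i)).trans hv
  have t1 : ∑ i, 2 * (1 + δ)⁻¹ * u i ^ 2 ≤ ∑ i, 2 * (A⁻¹ i i * d i) * u i ^ 2 :=
    Finset.sum_le_sum fun i _ => by gcongr; exact h.inv_diag_lower i
  have t3 : ∑ i, ∑ j, A⁻¹ i j ^ 2 * (d i * u i) * (d j * u j) ≤
      ∑ i, ((1 - δ) ^ 2)⁻¹ * u i ^ 2 := by
    have a1 : ∑ i, ∑ j, A⁻¹ i j ^ 2 * (d i * u i) * (d j * u j) ≤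
        ∑ i, ∑ j, (A⁻¹ i j ^ 2 * d i * d j * u i ^ 2 / 2 + A⁻¹ i j ^ 2 * d i * d j * u j ^ 2 / 2) := by
      refine Finset.sum_le_sum fun i _ => Finset.sum_le_sum fun j _ => ?_
      have : 0 ≤ A⁻¹ i j ^ 2 * d i * d j * (u i - u j) ^ 2 :=
        mul_nonneg (mul_nonneg (mul_nonneg (sq_nonneg _) (h.pos i).le) (h.pos j).le) (sq_nonneg _)
      nlinarith
    have a2 : ∑ i, ∑ j, A⁻¹ i j ^ 2 * d i * d j * u j ^ 2 / 2 =
        ∑ i, ∑ j, A⁻¹ i j ^ 2 * d i * d j * u i ^ 2 / 2 := by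
      rw [Finset.sum_comm]
      refine Finset.sum_congr rfl fun i _ => Finset.sum_congr rfl fun j _ => ?_
      rw [h.inv_symm j i]; ring
    refine a1.trans ?_
    simp only [Finset.sum_add_distrib]
    rw [a2, ← two_mul, Finset.mul_sum]
    refine Finset.sum_le_sum fun i _ => ?_
    have hd := h.pos i
    calc _ = d i * u i ^ 2 * ∑ j, A⁻¹ i j ^ 2 * d j := by
          simp only [Finset.mul_sum]
          exact Finset.sum_congr rfl fun j _ => by ring
      _ ≤ d i * u i ^ 2 * (((1 - δ) ^ 2)⁻¹ / d i) := by
          gcongr; exact h.sum_inv_entry_sq_mul_le i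
      _ = _ := by field_simp
  have t4 : (1 + δ)⁻¹ * ∑ i, d i * α i ^ 2 * u i ^ 2 ≤
      (fun i => d i * u i * α i) ⬝ᵥ A⁻¹ *ᵥ fun i => d i * u i * α i := by
    refine le_trans (le_of_eq ?_) (h.inv_quadratic_lower _)
    congr 1
    refine Finset.sum_congr rfl fun i _ => ?_
    have := (h.pos i).ne'
    field_simp
  have t2 : ∑ i, d i * α i ^ 2 * u i ^ 2 ≤ v * ∑ i, u i ^ 2 := by
    rw [Finset.mul_sum]
    exact Finset.sum_le_sum fun i _ => by gcongr; exact hcoord i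
  have hle : (1 + δ)⁻¹ ≤ 1 := inv_le_one_of_one_le₀ (by linarith)
  have hU : 0 ≤ ∑ i, u i ^ 2 := Finset.sum_nonneg fun i _ => sq_nonneg _
  have t2' := mul_le_mul_of_nonneg_left t2 (sub_nonneg.2 hle)
  have hm' := mul_le_mul_of_nonneg_right hm hU
  have e2 : ∑ i, 2 * (d i * α i ^ 2) * u i ^ 2 = 2 * ∑ i, d i * α i ^ 2 * u i ^ 2 := by
    rw [Finset.mul_sum]; exact Finset.sum_congr rfl fun i _ => by ring
  rw [e, e2]
  rw [← Finset.mul_sum] at t1 t3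
  nlinarith

/-- Smoothness along a coordinate direction. There, the diagonal entry `b` of `D A⁻¹` enters through
`2 b - b ^ 2 ≤ 1`. -/
lemma secondVar_upper {y : Fin n → ℝ} {v M : ℝ}
    (hv : ∑ i, d i * (A⁻¹ *ᵥ y) i ^ 2 ≤ v) (hM : 1 + 2 * ((1 - δ)⁻¹ - 1) * v ≤ M) (j : Fin n)
    {u : Fin n → ℝ} (hu : ∀ i, i ≠ j → u i = 0) :
    secondVar A⁻¹ y (fun i => d i * u i) (fun i => 2 * (d i * u i ^ 2)) ≤ M * u j ^ 2 := by
  set α := A⁻¹ *ᵥ y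
  have e : secondVar A⁻¹ y (fun i => d i * u i) (fun i => 2 * (d i * u i ^ 2)) =
      (2 * (A⁻¹ j j * d j) - (A⁻¹ j j * d j) ^ 2 +
        2 * (d j * α j ^ 2) * (A⁻¹ j j * d j - 1)) * u j ^ 2 := by
    rw [secondVar, Fintype.sum_eq_single j fun i hi => by simp [hu i hi],
      Fintype.sum_eq_single j fun i hi => by simp [hu i hi],
      Fintype.sum_eq_single j fun i hi => by simp [hu i hi]]
    ring
  rw [e]
  refine mul_le_mul_of_nonneg_right (le_trans ?_ hM) (sq_nonneg _)
  have hcoord : d j * α j ^ 2 ≤ v :=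
    (Finset.single_le_sum (f := fun i => d i * α i ^ 2)
      (fun j _ => mul_nonneg (h.pos j).le (sq_nonneg _)) (Finset.mem_univ j)).trans hv
  have hc0 : 0 ≤ d j * α j ^ 2 := mul_nonneg (h.pos j).le (sq_nonneg _)
  have hb := h.inv_diag_upper j
  have hδ : 0 < 1 - δ := by linarith [h.lt_one]
  have h1 : 1 ≤ (1 - δ)⁻¹ := (one_le_inv₀ hδ).2 (by linarith [h.nonneg])
  have a1 : d j * α j ^ 2 * (A⁻¹ j j * d j - 1) ≤ d j * α j ^ 2 * ((1 - δ)⁻¹ - 1) := by gcongr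
  have a2 : d j * α j ^ 2 * ((1 - δ)⁻¹ - 1) ≤ v * ((1 - δ)⁻¹ - 1) :=
    mul_le_mul_of_nonneg_right hcoord (by linarith)
  nlinarith [sq_nonneg (A⁻¹ j j * d j - 1)]

end NearDiagonal

end Variations

/-! ### Orthogonal matching pursuit on a box -/

section Existence

variable {n : ℕ} {smax : ℝ} {F : (Fin n → ℝ) → ℝ}

lemma mem_feasible (h0 : 0 ≤ smax) {s : Fin n → ℝ} :
    s ∈ feasible n smax ↔ ∀ i, 0 ≤ s i ∧ s i ≤ smax := by
  constructor
  · rintro ⟨h1, h2⟩ i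
    exact ⟨h1 i, (le_abs_self _).trans ((pi_norm_le_iff_of_nonneg h0).1 h2 i)⟩
  · refine fun h => ⟨fun i => (h i).1, (pi_norm_le_iff_of_nonneg h0).2 fun i => ?_⟩
    rw [Real.norm_of_nonneg (h i).1]
    exact (h i).2

lemma zero_mem_feasible (h0 : 0 ≤ smax) : (0 : Fin n → ℝ) ∈ feasible n smax :=
  (mem_feasible h0).2 fun _ => ⟨le_rfl, h0⟩

lemma feasible_eq_Icc (h0 : 0 ≤ smax) : feasible n smax = Set.Icc 0 fun _ => smax := by
  ext s
  rw [mem_feasible h0, Set.mem_Icc, Pi.le_def, Pi.le_def, ← forall_and]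
  rfl

lemma exists_isSupportMax (h0 : 0 ≤ smax) (hF : ContinuousOn F (feasible n smax))
    (S : Finset (Fin n)) : ∃ s, IsSupportMax F (feasible n smax) S s := by
  have hcl : IsClosed {s : Fin n → ℝ | ∀ i ∉ S, s i = 0} := by
    simp only [Set.ofPred_forall]
    exact isClosed_iInter fun i => isClosed_iInter fun _ =>
      isClosed_eq (continuous_apply i) continuous_const
  have hc : IsCompact (feasible n smax ∩ {s | ∀ i ∉ S, s i = 0}) := by
    rw [feasible_eq_Icc h0]; exact isCompact_Icc.inter_right hcl
  obtain ⟨s, hs, hmax⟩ := hc.exists_isMaxOn ⟨0, zero_mem_feasible h0, fun _ _ => rfl⟩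
    (hF.mono Set.inter_subset_left)
  exact ⟨s, hs, fun t ht hS => hmax ⟨ht, hS⟩⟩

lemma exists_isSparseMax (h0 : 0 ≤ smax) (hF : ContinuousOn F (feasible n smax)) (r : ℕ) :
    ∃ s, IsSparseMax F (feasible n smax) r s := by
  choose f hf using exists_isSupportMax h0 hF
  obtain ⟨S, hS, hmax⟩ := Finset.exists_max_image
    (Finset.univ.filter fun S : Finset (Fin n) => S.card ≤ r) (fun S => F (f S)) ⟨∅, by simp⟩
  refine ⟨f S, ⟨(hf S).1.1, ?_⟩, fun t ht htr => ?_⟩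
  · refine le_trans ?_ (Finset.mem_filter.1 hS).2
    rw [numNonzero, ← Set.ncard_coe_finset S]
    refine Set.ncard_le_ncard (fun i hi => ?_) S.finite_toSet
    by_contra hiS
    exact hi ((hf S).1.2 i hiS)
  · set T := Finset.univ.filter fun i => t i ≠ 0 with hT
    have hTr : T.card ≤ r := by
      rw [← Set.ncard_coe_finset]; simpa [hT, numNonzero] using htr
    exact ((hf T).2 t ht fun i hi => by simpa [hT] using hi).trans
      (hmax T (Finset.mem_filter.2 ⟨Finset.mem_univ _, hTr⟩))

lemma OMP.isSupportMax {D : Set (Fin n → ℝ)} {i : ℕ} {S : Finset (Fin n)} {s : Fin n → ℝ}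
    (h : OMP F D i S s) : IsSupportMax F D S s := by
  cases h with
  | init _ hs => exact hs
  | step _ _ _ _ _ _ _ _ hs' => exact hs'

lemma exists_OMP (h0 : 0 ≤ smax) (hF : ContinuousOn F (feasible n smax)) (r : ℕ) (hr : r ≤ n) :
    ∃ S s, OMP F (feasible n smax) r S s ∧ S.card = r := by
  induction r with
  | zero =>
    obtain ⟨s, hs⟩ := exists_isSupportMax h0 hF ∅
    exact ⟨∅, s, .init s hs, rfl⟩
  | succ r ih =>
    obtain ⟨S, s, h, hS⟩ := ih (by omega)
    have hne : Sᶜ.Nonempty := by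
      rw [← Finset.card_pos, Finset.card_compl, Fintype.card_fin]; omega
    obtain ⟨j, hj, hmax⟩ := Finset.exists_max_image Sᶜ (gradSize F s) hne
    obtain ⟨s', hs'⟩ := exists_isSupportMax h0 hF (insert j S)
    rw [Finset.mem_compl] at hj
    exact ⟨insert j S, s', .step r S s j s' h hj
      (fun j' hj' => hmax j' (Finset.mem_compl.2 hj')) hs',
      by rw [Finset.card_insert_of_notMem hj, hS]⟩

/-- The first-order optimality condition for a maximizer over a face of the box. -/
lemma IsSupportMax.fderiv_sub_nonpos (h0 : 0 ≤ smax) {S : Finset (Fin n)} {s w : Fin n → ℝ}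
    (hs : IsSupportMax F (feasible n smax) S s) (hd : DifferentiableAt ℝ F s)
    (hw : w ∈ feasible n smax) (hwS : ∀ i ∉ S, w i = 0) : fderiv ℝ F s (w - s) ≤ 0 := by
  have hmax : IsLocalMaxOn F (segment ℝ s w) s := by
    refine IsMaxOn.localize fun t ht => ?_
    obtain ⟨a, b, ha, hb, hab, rfl⟩ := ht
    refine hs.2 _ ?_ fun i hi => by simp [hs.1.2 i hi, hwS i hi]
    rw [feasible_eq_Icc h0]
    exact convex_Icc _ _ (feasible_eq_Icc h0 ▸ hs.1.1) (feasible_eq_Icc h0 ▸ hw) ha hb hab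
  exact hmax.hasFDerivWithinAt_nonpos hd.hasFDerivAt.hasFDerivWithinAt
    (sub_mem_posTangentConeAt_of_segment_subset subset_rfl)

end Existence

section Guarantee

variable {n : ℕ} {smax m M : ℝ} {F : (Fin n → ℝ) → ℝ}

/-- One step of OMP closes at least the fraction `m / (M r)` of the gap to any `r`-sparse feasible
vector `t`. The gap is at most the sum over the support of `t` of concave one-dimensional gains
`x ↦ g x - m x² / 2`, and moving by `(m / M) x` along the chosen coordinate, which does not leave
the box, realizes the fraction `m / M` of each of these. -/
lemma gap_le_mul_gain (h0 : 0 ≤ smax) (hm : 0 ≤ m) (hM : 0 < M) (hmM : m ≤ M)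
    (hdiff : ∀ s ∈ feasible n smax, DifferentiableAt ℝ F s)
    (hconc : ∀ s ∈ feasible n smax, ∀ t ∈ feasible n smax,
      F t ≤ F s + fderiv ℝ F s (t - s) - m / 2 * ∑ i, (t i - s i) ^ 2)
    (hsmooth : ∀ s ∈ feasible n smax, ∀ j, ∀ x, 0 ≤ x → x ≤ smax → s j = 0 →
      F s + x * fderiv ℝ F s (Pi.single j 1) - M / 2 * x ^ 2 ≤ F (s + Pi.single j x))
    {S : Finset (Fin n)} {s s' t : Fin n → ℝ} {j : Fin n} (hj : j ∉ S)
    (hs : IsSupportMax F (feasible n smax) S s)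
    (hmax : ∀ j' ∉ S, gradSize F s j' ≤ gradSize F s j)
    (hs' : IsSupportMax F (feasible n smax) (insert j S) s')
    (ht : t ∈ feasible n smax) {r : ℕ} (htr : numNonzero t ≤ r) :
    m / M * (F t - F s) ≤ r * (F s' - F s) := by
  set g := gradSize F s j with hg
  have hsb := (mem_feasible h0).1 hs.1.1
  have htb := (mem_feasible h0).1 ht
  have hq0 : 0 ≤ m / M := div_nonneg hm hM.le
  have hq1 : m / M ≤ 1 := (div_le_one hM).2 hmM
  have hgain0 : F s ≤ F s' := hs'.2 s hs.1.1 fun i hi =>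
    hs.1.2 i fun h => hi (Finset.mem_insert_of_mem h)
  have hgain : ∀ x, 0 ≤ x → x ≤ smax → m / M * (g * x - m / 2 * x ^ 2) ≤ F s' - F s := by
    intro x hx0 hx1
    rcases le_or_gt (fderiv ℝ F s (Pi.single j 1)) 0 with hneg | hpos
    -- a nonpositive partial derivative is projected to zero, and then there is nothing to gain
    · have : g = 0 := max_eq_right hneg
      rw [this]
      have : 0 ≤ m / M * (m / 2 * x ^ 2) := by positivity
      linarith
    · have hg' : fderiv ℝ F s (Pi.single j 1) = g := (max_eq_left hpos.le).symm
      have hy0 : 0 ≤ m / M * x := mul_nonneg hq0 hx0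
      have hy1 : m / M * x ≤ smax := (mul_le_of_le_one_left hx0 hq1).trans hx1
      have hsj := hs.1.2 j hj
      have h1 := hsmooth s hs.1.1 j (m / M * x) hy0 hy1 hsj
      have h2 : F (s + Pi.single j (m / M * x)) ≤ F s' := by
        refine hs'.2 _ ((mem_feasible h0).2 fun i => ?_) fun i hi => ?_
        · by_cases hij : i = j
          · subst hij; simpa [hsj] using And.intro hy0 hy1
          · simpa [hij] using hsb i
        · rw [Finset.mem_insert, not_or] at hi
          simp [hi.1, hs.1.2 i hi.2]
      rw [hg'] at h1
      have h3 : M / 2 * (m / M * x) ^ 2 = m / M * (m / 2 * x ^ 2) := by field_simp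
      linarith
  set T := Finset.univ.filter fun i => t i ≠ 0 with hT
  have hTr : (T.card : ℝ) ≤ r := by
    have : T.card ≤ r := by
      rw [← Set.ncard_coe_finset]; simpa [hT, numNonzero] using htr
    exact_mod_cast this
  -- restrict `t` to `S`: there the first-order condition applies
  set w : Fin n → ℝ := fun i => if i ∈ S then t i else 0 with hw
  have hwD : w ∈ feasible n smax := (mem_feasible h0).2 fun i => by
    by_cases hi : i ∈ S
    · simpa [hw, hi] using htb i
    · simp [hw, hi, h0]
  have hfirst := hs.fderiv_sub_nonpos h0 (hdiff s hs.1.1) hwD fun i hi => by simp [hw, hi]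
  have hdec : t - s = (w - s) + ∑ i ∈ T \ S, t i • Pi.single (M := fun _ => ℝ) i 1 := by
    ext k
    by_cases hk : k ∈ S <;> by_cases hk' : t k = 0 <;>
      simp [hw, hT, hk, hk', Finset.sum_apply, Pi.single_apply, sub_eq_neg_add]
  have hlin : fderiv ℝ F s (t - s) ≤ ∑ i ∈ T \ S, g * t i := by
    rw [hdec, map_add, map_sum]
    refine (add_le_of_nonpos_left hfirst).trans (Finset.sum_le_sum fun i hi => ?_)
    rw [map_smul, smul_eq_mul, mul_comm]
    exact mul_le_mul_of_nonneg_right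
      ((le_max_left _ _).trans (hmax i (Finset.mem_sdiff.1 hi).2)) (htb i).1
  have hsq : ∑ i ∈ T \ S, t i ^ 2 ≤ ∑ i, (t i - s i) ^ 2 := by
    refine le_trans (Finset.sum_le_sum fun i hi => ?_)
      (Finset.sum_le_univ_sum_of_nonneg fun i => sq_nonneg _)
    rw [hs.1.2 i (Finset.mem_sdiff.1 hi).2, sub_zero]
  have hgap : F t - F s ≤ ∑ i ∈ T \ S, (g * t i - m / 2 * t i ^ 2) := by
    rw [Finset.sum_sub_distrib, ← Finset.mul_sum (f := fun i => t i ^ 2)]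
    have := mul_le_mul_of_nonneg_left hsq (div_nonneg hm zero_le_two)
    linarith [hconc s hs.1.1 t ht]
  calc m / M * (F t - F s) ≤ m / M * ∑ i ∈ T \ S, (g * t i - m / 2 * t i ^ 2) :=
        mul_le_mul_of_nonneg_left hgap hq0
    _ = ∑ i ∈ T \ S, m / M * (g * t i - m / 2 * t i ^ 2) := Finset.mul_sum _ _ _
    _ ≤ ∑ i ∈ T \ S, (F s' - F s) := Finset.sum_le_sum fun i _ => hgain _ (htb i).1 (htb i).2
    _ = ((T \ S).card : ℝ) * (F s' - F s) := by rw [Finset.sum_const, nsmul_eq_mul]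
    _ ≤ r * (F s' - F s) := by
        refine mul_le_mul_of_nonneg_right (le_trans ?_ hTr) (sub_nonneg.2 hgain0)
        exact_mod_cast Finset.card_le_card Finset.sdiff_subset

/-- The approximation guarantee of OMP for an `m`-strongly concave objective on a box that is
`M`-smooth along coordinate directions. -/
theorem OMP.approximation_guarantee (h0 : 0 ≤ smax) (hm : 0 ≤ m) (hM : 0 < M) (hmM : m ≤ M)
    (hdiff : ∀ s ∈ feasible n smax, DifferentiableAt ℝ F s)
    (hconc : ∀ s ∈ feasible n smax, ∀ t ∈ feasible n smax,
      F t ≤ F s + fderiv ℝ F s (t - s) - m / 2 * ∑ i, (t i - s i) ^ 2)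
    (hsmooth : ∀ s ∈ feasible n smax, ∀ j, ∀ x, 0 ≤ x → x ≤ smax → s j = 0 →
      F s + x * fderiv ℝ F s (Pi.single j 1) - M / 2 * x ^ 2 ≤ F (s + Pi.single j x))
    {r : ℕ} {S : Finset (Fin n)} {s t : Fin n → ℝ} (h : OMP F (feasible n smax) r S s)
    (ht : IsSparseMax F (feasible n smax) r t) :
    (1 - Real.exp (-(m / M))) * (F t - F 0) ≤ F s - F 0 := by
  have hinit : ∀ z, IsSupportMax F (feasible n smax) ∅ z → z = 0 := fun z hz =>
    funext fun i => hz.1.2 i (Finset.notMem_empty i)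
  have hgap0 : 0 ≤ F t - F 0 := sub_nonneg.2 (ht.2 0 (zero_mem_feasible h0) (by simp [numNonzero]))
  rcases Nat.eq_zero_or_pos r with rfl | hr
  · have hz : t = 0 := by
      have := (Nat.le_zero.1 ht.1.2)
      rw [numNonzero, Set.ncard_eq_zero (Set.toFinite _)] at this
      funext i
      by_contra hi
      exact (Set.mem_empty_iff_false i).1 (this ▸ hi)
    cases h with
    | init _ hs => rw [hinit s hs, hz]; simp
  have hr' : (0 : ℝ) < r := Nat.cast_pos.2 hr
  set c := m / M / r with hc
  have hq1 : m / M ≤ 1 := (div_le_one hM).2 hmM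
  have hc1 : 0 ≤ 1 - c := sub_nonneg.2 ((div_le_one hr').2 (hq1.trans (by exact_mod_cast hr)))
  have key : ∀ i S s, OMP F (feasible n smax) i S s → F t - F s ≤ (1 - c) ^ i * (F t - F 0) := by
    intro i S s h
    induction h with
    | init s hs => rw [hinit s hs]; simp
    | step i S s j s' h hj hmax hs' ih =>
      have h1 := gap_le_mul_gain h0 hm hM hmM hdiff hconc hsmooth hj h.isSupportMax hmax hs'
        ht.1.1 ht.1.2
      have h2 : c * (F t - F s) ≤ F s' - F s := by
        rw [hc, div_mul_eq_mul_div, div_le_iff₀ hr']; linarith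
      have h3 := mul_le_mul_of_nonneg_left ih hc1
      rw [pow_succ]
      linarith
  have hexp : (1 - c) ^ r ≤ Real.exp (-(m / M)) := by
    calc (1 - c) ^ r ≤ Real.exp (-c) ^ r := pow_le_pow_left₀ hc1 (Real.one_sub_le_exp_neg c) r
      _ = Real.exp (-(m / M)) := by
        rw [← Real.exp_nat_mul, hc]; congr 1; field_simp
  have := (key r S s h).trans (mul_le_mul_of_nonneg_right hexp hgap0)
  linarith

end Guarantee

/-! ### The covariance matrices on the feasible box -/

section Covariance

variable {n : ℕ}

lemma isPosSemidef_baseCov {X : Type*} {k : X → X → ℝ} (hk : IsPSDKernel k) (σ : ℝ)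
    (x : Fin n → X) : (baseCov k σ x).PosSemidef :=
  (hk n x).add (Matrix.PosSemidef.one.smul (sq_nonneg σ))

lemma minEigenvalue_pos_and_le_diag [NeZero n] {A : Matrix (Fin n) (Fin n) ℝ} (hA : A.PosDef) :
    0 < minEigenvalue A ∧ ∀ i, minEigenvalue A ≤ A i i := by
  have hspec := hA.isHermitian.spectrum_real_eq_range_eigenvalues
  have hfin : (spectrum ℝ A).Finite := hspec ▸ Set.finite_range _
  have hne : (spectrum ℝ A).Nonempty := hspec ▸ Set.range_nonempty _
  constructor
  · obtain ⟨i, hi⟩ := hspec.subset (hne.csInf_mem hfin)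
    rw [minEigenvalue, ← hi]
    exact hA.eigenvalues_pos i
  · intro i
    have hpsd : (A - algebraMap ℝ _ (minEigenvalue A)).PosSemidef := by
      refine Matrix.posSemidef_iff_isHermitian_and_spectrum_nonneg.2 ⟨?_, ?_⟩
      · refine hA.isHermitian.sub ?_
        rw [Algebra.algebraMap_eq_smul_one]
        simp [Matrix.IsHermitian]
      · rw [← spectrum.sub_singleton_eq]
        rintro _ ⟨a, ha, _, rfl, rfl⟩
        exact sub_nonneg.2 (csInf_le hfin.bddBelow ha)
    have := hpsd.diag_nonneg (i := i)
    simpa [Matrix.algebraMap_matrix_apply] using this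

/-- Adding a nonnegative diagonal preserves diagonal dominance, which bounds the quadratic form by
`2 |x i x j| ≤ x i ^ 2 + x j ^ 2`. -/
lemma DiagDominant.nearDiagonal {δ : ℝ} {A : Matrix (Fin n) (Fin n) ℝ} (hdd : DiagDominant δ A)
    (hA : A.PosSemidef) (hδ0 : 0 ≤ δ) (hδ1 : δ < 1) {ρ : Fin n → ℝ} (hρ : ∀ i, 0 ≤ ρ i) :
    NearDiagonal δ (fun i => A i i + ρ i) (A + Matrix.diagonal ρ) := by
  have hsymm : ∀ i j, A i j = A j i := fun i j => by simpa using hA.isHermitian.apply j i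
  have hpos : ∀ i, 0 < A i i := fun i => by
    refine lt_of_le_of_ne hA.diag_nonneg fun h0 => ?_
    have h := hdd i
    rw [← h0, abs_zero, mul_zero] at h
    exact absurd h (not_lt.2 (Finset.sum_nonneg fun _ _ => abs_nonneg _))
  have hquad : ∀ x : Fin n → ℝ, x ⬝ᵥ (A + Matrix.diagonal ρ) *ᵥ x =
      ∑ i, (A i i + ρ i) * x i ^ 2 + ∑ i, ∑ j ∈ Finset.univ.erase i, A i j * x i * x j := fun x => by
    rw [Matrix.add_mulVec, dotProduct_add, ← Finset.sum_add_distrib]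
    simp only [dotProduct, ← Finset.sum_add_distrib]
    refine Finset.sum_congr rfl fun i _ => ?_
    rw [Matrix.mulVec_diagonal, Matrix.mulVec, dotProduct,
      ← Finset.add_sum_erase _ _ (Finset.mem_univ i), mul_add, Finset.mul_sum]
    have : ∑ j ∈ Finset.univ.erase i, x i * (A i j * x j) =
        ∑ j ∈ Finset.univ.erase i, A i j * x i * x j :=
      Finset.sum_congr rfl fun j _ => by ring
    rw [this]; ring
  have hoff : ∀ x : Fin n → ℝ, |∑ i, ∑ j ∈ Finset.univ.erase i, A i j * x i * x j| ≤
      δ * ∑ i, (A i i + ρ i) * x i ^ 2 := fun x => by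
    have hswap : ∑ i, ∑ j ∈ Finset.univ.erase i, |A i j| * x j ^ 2 / 2 =
        ∑ i, ∑ j ∈ Finset.univ.erase i, |A i j| * x i ^ 2 / 2 := by
      rw [Finset.sum_comm' (t' := Finset.univ) (s' := fun j => Finset.univ.erase j)
        (by simp [ne_comm])]
      exact Finset.sum_congr rfl fun i _ => Finset.sum_congr rfl fun j _ => by rw [hsymm]
    calc |∑ i, ∑ j ∈ Finset.univ.erase i, A i j * x i * x j|
        ≤ ∑ i, ∑ j ∈ Finset.univ.erase i, |A i j * x i * x j| :=
          (Finset.abs_sum_le_sum_abs _ _).trans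
            (Finset.sum_le_sum fun i _ => Finset.abs_sum_le_sum_abs _ _)
      _ ≤ ∑ i, ∑ j ∈ Finset.univ.erase i, (|A i j| * x i ^ 2 / 2 + |A i j| * x j ^ 2 / 2) := by
          refine Finset.sum_le_sum fun i _ => Finset.sum_le_sum fun j _ => ?_
          rw [abs_mul, abs_mul, mul_assoc, ← add_div, ← mul_add, mul_div_assoc]
          refine mul_le_mul_of_nonneg_left ?_ (abs_nonneg _)
          nlinarith [sq_nonneg (|x i| - |x j|), sq_abs (x i), sq_abs (x j)]
      _ = ∑ i, (∑ j ∈ Finset.univ.erase i, |A i j|) * x i ^ 2 := by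
          simp only [Finset.sum_add_distrib]
          rw [hswap, ← Finset.sum_add_distrib]
          refine Finset.sum_congr rfl fun i _ => ?_
          rw [← Finset.sum_add_distrib, Finset.sum_mul]
          exact Finset.sum_congr rfl fun j _ => by ring
      _ ≤ ∑ i, δ * ((A i i + ρ i) * x i ^ 2) := by
          refine Finset.sum_le_sum fun i _ => ?_
          rw [← mul_assoc]
          refine mul_le_mul_of_nonneg_right ((hdd i).le.trans ?_) (sq_nonneg _)
          rw [abs_of_pos (hpos i)]
          exact mul_le_mul_of_nonneg_left (le_add_of_nonneg_right (hρ i)) hδ0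
      _ = _ := by rw [Finset.mul_sum]
  refine ⟨hδ0, hδ1, fun i => add_pos_of_pos_of_nonneg (hpos i) (hρ i), fun i j => ?_,
    fun x => ?_, fun x => ?_⟩
  · rw [Matrix.add_apply, Matrix.add_apply, hsymm i j]
    congr 1
    by_cases hij : i = j
    · rw [hij]
    · rw [Matrix.diagonal_apply_ne _ hij, Matrix.diagonal_apply_ne' _ hij]
  · rw [hquad]
    linarith [(abs_le.1 (hoff x)).1]
  · rw [hquad]
    linarith [(abs_le.1 (hoff x)).2]

lemma rhoOf_zero (K₀ : Matrix (Fin n) (Fin n) ℝ) : rhoOf K₀ 0 = 0 := by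
  ext i; simp [rhoOf]

lemma rhoOf_nonneg {K₀ : Matrix (Fin n) (Fin n) ℝ} (hK₀ : ∀ i, 0 ≤ K₀ i i) {s : Fin n → ℝ}
    (hs : ∀ i, 0 ≤ s i ∧ s i < 1) (i : Fin n) : 0 ≤ rhoOf K₀ s i :=
  mul_nonneg (hK₀ i) (sub_nonneg.2 ((one_le_inv₀ (by linarith [(hs i).2])).2
    (by linarith [(hs i).1])))

lemma add_rhoOf (K₀ : Matrix (Fin n) (Fin n) ℝ) (s : Fin n → ℝ) (i : Fin n) :
    K₀ i i + rhoOf K₀ s i = K₀ i i * (1 - s i)⁻¹ := by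
  rw [rhoOf]; ring

lemma differentiableAt_rhoOf (K₀ : Matrix (Fin n) (Fin n) ℝ) {s : Fin n → ℝ} (hs : ∀ i, s i ≠ 1) :
    DifferentiableAt ℝ (rhoOf K₀) s := by
  refine differentiableAt_pi.2 fun i => ?_
  have : 1 - s i ≠ 0 := sub_ne_zero.2 (hs i).symm
  unfold rhoOf
  fun_prop (disch := exact this)

/-- Along a line in the parameters `s` with direction `Δ`, the velocity of `ρ(s)` is `D u` where `D`
is the diagonal of the covariance and `u = Δ / (1 - s)`. -/
lemma hasDerivAt_rhoOf_line (K₀ : Matrix (Fin n) (Fin n) ℝ) (s Δ : Fin n → ℝ) {τ : ℝ}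
    (hs : ∀ i, (s + τ • Δ) i ≠ 1) :
    HasDerivAt (fun τ => rhoOf K₀ (s + τ • Δ))
      (fun i => K₀ i i * (1 - (s + τ • Δ) i)⁻¹ * (Δ i * (1 - (s + τ • Δ) i)⁻¹)) τ := by
  refine hasDerivAt_pi.2 fun i => ?_
  have h0 : 1 - (s + τ • Δ) i ≠ 0 := sub_ne_zero.2 (hs i).symm
  have h1 : HasDerivAt (fun τ : ℝ => 1 - (s + τ • Δ) i) (-Δ i) τ := by
    simpa using (((hasDerivAt_id τ).mul_const (Δ i)).const_add (s i)).const_sub 1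
  refine (((h1.inv h0).sub_const 1).const_mul (K₀ i i)).congr_deriv ?_
  rw [neg_neg]
  field_simp

lemma hasDerivAt_rhoOf_line_velocity (K₀ : Matrix (Fin n) (Fin n) ℝ) (s Δ : Fin n → ℝ) {τ : ℝ}
    (hs : ∀ i, (s + τ • Δ) i ≠ 1) :
    HasDerivAt
      (fun τ i => K₀ i i * (1 - (s + τ • Δ) i)⁻¹ * (Δ i * (1 - (s + τ • Δ) i)⁻¹))
      (fun i => 2 * (K₀ i i * (1 - (s + τ • Δ) i)⁻¹ * (Δ i * (1 - (s + τ • Δ) i)⁻¹) ^ 2)) τ := by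
  refine hasDerivAt_pi.2 fun i => ?_
  have h0 : 1 - (s + τ • Δ) i ≠ 0 := sub_ne_zero.2 (hs i).symm
  have h1 : HasDerivAt (fun τ : ℝ => 1 - (s + τ • Δ) i) (-Δ i) τ := by
    simpa using (((hasDerivAt_id τ).mul_const (Δ i)).const_add (s i)).const_sub 1
  have h2 := h1.inv h0
  refine ((h2.const_mul (K₀ i i)).mul (h2.const_mul (Δ i))).congr_deriv ?_
  simp only [Pi.inv_apply, neg_neg]
  field_simp
  ring

end Covariance

/-! ### Curvature of the log marginal likelihood -/

section Curvature

/-- A lower bound `c` for the second derivative on `[0, 1]` gives a second-order expansion. -/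
lemma second_order_lower {f f' f'' : ℝ → ℝ} {c : ℝ}
    (hf : ∀ τ ∈ Set.Icc (0 : ℝ) 1, HasDerivAt f (f' τ) τ)
    (hf' : ∀ τ ∈ Set.Icc (0 : ℝ) 1, HasDerivAt f' (f'' τ) τ)
    (hc : ∀ τ ∈ Set.Icc (0 : ℝ) 1, c ≤ f'' τ) : f 0 + f' 0 + c / 2 ≤ f 1 := by
  have h01 : (0 : ℝ) ∈ Set.Icc (0 : ℝ) 1 := Set.left_mem_Icc.2 zero_le_one
  have hmono : ∀ g g' : ℝ → ℝ, (∀ τ ∈ Set.Icc (0 : ℝ) 1, HasDerivAt g (g' τ) τ) →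
      (∀ τ ∈ Set.Icc (0 : ℝ) 1, 0 ≤ g' τ) → MonotoneOn g (Set.Icc 0 1) := fun g g' hg hg' =>
    monotoneOn_of_deriv_nonneg (convex_Icc 0 1)
      (fun τ hτ => (hg τ hτ).continuousAt.continuousWithinAt)
      (fun τ hτ => (hg τ (interior_subset hτ)).differentiableAt.differentiableWithinAt)
      fun τ hτ => by
        rw [(hg τ (interior_subset hτ)).deriv]; exact hg' τ (interior_subset hτ)
  have h1 := hmono (fun τ => f' τ - c * τ) (fun τ => f'' τ - c)
    (fun τ hτ => ((hf' τ hτ).sub ((hasDerivAt_id τ).const_mul c)).congr_deriv (by simp))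
    fun τ hτ => sub_nonneg.2 (hc τ hτ)
  have h2 := hmono (fun τ => f τ - f' 0 * τ - c / 2 * τ ^ 2) (fun τ => f' τ - f' 0 - c * τ)
    (fun τ hτ => by
      refine (((hf τ hτ).sub ((hasDerivAt_id τ).const_mul (f' 0))).sub
        (((hasDerivAt_id τ).pow 2).const_mul (c / 2))).congr_deriv ?_
      simp
      ring)
    fun τ hτ => by
      have := h1 h01 hτ hτ.1
      simp only [mul_zero, sub_zero] at this
      linarith
  have := h2 h01 (Set.right_mem_Icc.2 zero_le_one) zero_le_one
  norm_num at this
  linarith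

variable {n : ℕ} {δ : ℝ} {K₀ : Matrix (Fin n) (Fin n) ℝ} {y : EuclideanSpace ℝ (Fin n)} {smax : ℝ}

/-- The second-order expansion of `-2 L(ρ(s))` between two points of the box, with curvature
bounds transferred from `secondVar`. -/
lemma logML_second_order (h0 : 0 ≤ smax) (h1 : smax < 1)
    (hnear : ∀ z ∈ feasible n smax, NearDiagonal δ (fun i => K₀ i i * (1 - z i)⁻¹)
      (K₀ + Matrix.diagonal (rhoOf K₀ z)))
    {s t : Fin n → ℝ} (hs : s ∈ feasible n smax) (ht : t ∈ feasible n smax) :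
    let F := fun z => logML K₀ y (rhoOf K₀ z)
    let Q := fun z : Fin n → ℝ => secondVar (K₀ + Matrix.diagonal (rhoOf K₀ z))⁻¹ (fun i => y i)
      (fun i => K₀ i i * (1 - z i)⁻¹ * ((t - s) i * (1 - z i)⁻¹))
      (fun i => 2 * (K₀ i i * (1 - z i)⁻¹ * ((t - s) i * (1 - z i)⁻¹) ^ 2))
    DifferentiableAt ℝ F s ∧
    (∀ c, (∀ z ∈ feasible n smax, c ≤ Q z) → F t ≤ F s + fderiv ℝ F s (t - s) - c / 4) ∧
    (∀ c, (∀ z ∈ feasible n smax, Q z ≤ c) → F s + fderiv ℝ F s (t - s) - c / 4 ≤ F t) := by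
  intro F Q
  have hne : ∀ z ∈ feasible n smax, ∀ i, z i ≠ 1 := fun z hz i =>
    (((mem_feasible h0).1 hz i).2.trans_lt h1).ne
  have hpath : ∀ τ ∈ Set.Icc (0 : ℝ) 1, s + τ • (t - s) ∈ feasible n smax := fun τ hτ => by
    rw [feasible_eq_Icc h0] at hs ht ⊢
    exact (convex_Icc _ _).add_smul_sub_mem hs ht hτ
  have hdiff : DifferentiableAt ℝ F s :=
    differentiableAt_logML K₀ y (differentiableAt_rhoOf K₀ (hne s hs)) (hnear s hs).det_ne_zero
  set φ' : ℝ → ℝ := fun τ => firstVar (K₀ + Matrix.diagonal (rhoOf K₀ (s + τ • (t - s))))⁻¹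
    (fun i => y i) fun i => K₀ i i * (1 - (s + τ • (t - s)) i)⁻¹ *
      ((t - s) i * (1 - (s + τ • (t - s)) i)⁻¹) with hφ'
  have hd1 : ∀ τ ∈ Set.Icc (0 : ℝ) 1,
      HasDerivAt (fun τ => -2 * F (s + τ • (t - s))) (φ' τ) τ := fun τ hτ =>
    hasDerivAt_neg_two_logML K₀ y (hasDerivAt_rhoOf_line K₀ s (t - s) (hne _ (hpath τ hτ)))
      (hnear _ (hpath τ hτ)).det_ne_zero (hnear _ (hpath τ hτ)).inv_symm
  have hd2 : ∀ τ ∈ Set.Icc (0 : ℝ) 1, HasDerivAt φ' (Q (s + τ • (t - s))) τ := fun τ hτ =>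
    hasDerivAt_firstVar K₀ (fun i => y i) (hasDerivAt_rhoOf_line K₀ s (t - s) (hne _ (hpath τ hτ)))
      (hasDerivAt_rhoOf_line_velocity K₀ s (t - s) (hne _ (hpath τ hτ)))
      (hnear _ (hpath τ hτ)).det_ne_zero (hnear _ (hpath τ hτ)).inv_symm
  have hφ0 : φ' 0 = -2 * fderiv ℝ F s (t - s) := by
    have hline : HasDerivAt (fun τ : ℝ => s + τ • (t - s)) (t - s) 0 := by
      simpa using ((hasDerivAt_id (0 : ℝ)).smul_const (t - s)).const_add s
    have hF : HasFDerivAt F (fderiv ℝ F s) (s + (0 : ℝ) • (t - s)) := by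
      rw [zero_smul, add_zero]; exact hdiff.hasFDerivAt
    exact (hd1 0 (Set.left_mem_Icc.2 zero_le_one)).unique
      ((hF.comp_hasDerivAt (0 : ℝ) hline).const_mul (-2))
  refine ⟨hdiff, fun c hc => ?_, fun c hc => ?_⟩
  · have h := second_order_lower hd1 hd2 fun τ hτ => hc _ (hpath τ hτ)
    simp only [zero_smul, add_zero, one_smul, add_sub_cancel, hφ0] at h
    linarith
  · have h := second_order_lower (fun τ hτ => (hd1 τ hτ).neg) (fun τ hτ => (hd2 τ hτ).neg)
      (c := -c) fun τ hτ => neg_le_neg (hc _ (hpath τ hτ))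
    simp only [Pi.neg_apply, zero_smul, add_zero, one_smul, add_sub_cancel, hφ0] at h
    linarith

/-- In the metric of the covariance diagonal, the weights `K⁻¹ y` have size at most
`‖y‖² / (λ (1 - δ)²)` when `λ` bounds the diagonal of `K₀` from below. -/
lemma sum_mul_weights_sq_le (h0 : 0 ≤ smax) (h1 : smax < 1) {lam : ℝ} (hlam : 0 < lam)
    (hdiag : ∀ i, lam ≤ K₀ i i) {z : Fin n → ℝ} (hz : z ∈ feasible n smax)
    (hnear : NearDiagonal δ (fun i => K₀ i i * (1 - z i)⁻¹)
      (K₀ + Matrix.diagonal (rhoOf K₀ z))) :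
    ∑ i, K₀ i i * (1 - z i)⁻¹ *
        ((K₀ + Matrix.diagonal (rhoOf K₀ z))⁻¹ *ᵥ fun i => y i) i ^ 2 ≤
      ‖y‖ ^ 2 / (lam * (1 - δ) ^ 2) := by
  refine (hnear.sum_mul_inv_mulVec_sq_le _).trans ?_
  have : ∑ i, y i ^ 2 / (K₀ i i * (1 - z i)⁻¹) ≤ ‖y‖ ^ 2 / lam := by
    rw [EuclideanSpace.real_norm_sq_eq, Finset.sum_div]
    refine Finset.sum_le_sum fun i _ => div_le_div_of_nonneg_left (sq_nonneg _) hlam ?_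
    have hzi := (mem_feasible h0).1 hz i
    refine (hdiag i).trans (le_mul_of_one_le_right (hlam.le.trans (hdiag i)) ?_)
    exact (one_le_inv₀ (by linarith)).2 (by linarith)
  calc _ ≤ ((1 - δ) ^ 2)⁻¹ * (‖y‖ ^ 2 / lam) :=
        mul_le_mul_of_nonneg_left this (inv_nonneg.2 (sq_nonneg _))
    _ = _ := by rw [mul_comm lam, inv_mul_eq_div, div_div, mul_comm lam]

end Curvature

end RobustGP

/-! ### The approximation guarantee -/

theorem mainTheorem1 {X : Type*} (n : ℕ) (k : X → X → ℝ) (hk : RobustGP.IsPSDKernel k)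
    (σ : ℝ) (x : Fin n → X) (y : EuclideanSpace ℝ (Fin n))
    (K₀ : Matrix (Fin n) (Fin n) ℝ) (hK₀ : K₀ = RobustGP.baseCov k σ x)
    (δ m M smax : ℝ)
    (hdd : RobustGP.DiagDominant δ K₀)
    (hsmax : 0 < smax) (hsmax1 : smax < 1) (hm : 0 < m) (hM : 1 / (1 - smax) ^ 2 < M)
    -- the bounds on `δ` and `‖y‖` for strong convexity
    (hδ : δ < ((5 - m) - √((5 - m) ^ 2 - 8 * (1 - m))) / 4)
    (hconv : ‖y‖ ^ 2 ≤ RobustGP.minEigenvalue K₀ * (1 - δ) ^ 2 *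
      ((2 * (1 + δ)⁻¹ - ((1 - δ) ^ 2)⁻¹ - m) / (2 * (1 - (1 - δ) / (1 + δ)))))
    -- the bound on `‖y‖` for smoothness
    (hsmooth : ‖y‖ ^ 2 ≤ RobustGP.minEigenvalue K₀ * (1 - δ) ^ 2 *
      ((M * (1 - smax) ^ 2 - 1) / (2 * ((1 + δ) / (1 - δ) - 1))))
    (r : ℕ) (hr : 2 * r ≤ n)
    (F : (Fin n → ℝ) → ℝ) (hF : F = fun s => RobustGP.logML K₀ y (RobustGP.rhoOf K₀ s)) :
    -- orthogonal matching pursuit can be run for `r` steps, and optimal sparse vectors exist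
    (∃ S s, RobustGP.OMP F (RobustGP.feasible n smax) r S s) ∧
    (∃ s, RobustGP.IsSparseMax F (RobustGP.feasible n smax) r s) ∧
    -- the normalized optimal value over any support is nonnegative
    (∀ S s, RobustGP.IsSupportMax F (RobustGP.feasible n smax) S s →
      0 ≤ RobustGP.logML K₀ y (RobustGP.rhoOf K₀ s) - RobustGP.logML K₀ y 0) ∧
    -- the approximation guarantee
    ∀ S sOMP sOPT, RobustGP.OMP F (RobustGP.feasible n smax) r S sOMP →
      RobustGP.IsSparseMax F (RobustGP.feasible n smax) r sOPT →
      (1 - Real.exp (-(m / M))) *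
          (RobustGP.logML K₀ y (RobustGP.rhoOf K₀ sOPT) - RobustGP.logML K₀ y 0) ≤
        RobustGP.logML K₀ y (RobustGP.rhoOf K₀ sOMP) - RobustGP.logML K₀ y 0 := by
  open RobustGP in
  have hF0 : logML K₀ y 0 = F 0 := by rw [hF]; simp only [rhoOf_zero]
  have hFs : ∀ s, logML K₀ y (rhoOf K₀ s) = F s := fun s => by rw [hF]
  simp only [hF0, hFs]
  rcases Nat.eq_zero_or_pos n with rfl | hn
  · -- without data points there is only one vector
    have hcont : ContinuousOn F (feasible 0 smax) := (continuous_of_const fun a b =>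
      congrArg F (Subsingleton.elim a b)).continuousOn
    obtain ⟨S, s, h, -⟩ := exists_OMP hsmax.le hcont r (by omega)
    refine ⟨⟨S, s, h⟩, exists_isSparseMax hsmax.le hcont r, fun S s _ => ?_, fun S s t _ _ => ?_⟩
    · rw [Subsingleton.elim s 0, sub_self]
    · rw [Subsingleton.elim s 0, Subsingleton.elim t 0, sub_self, mul_zero]
  have : NeZero n := ⟨hn.ne'⟩
  have hpsd : K₀.PosSemidef := hK₀ ▸ isPosSemidef_baseCov hk σ x
  have hδ0 : 0 < δ := by
    have h := (Finset.sum_nonneg fun _ _ => abs_nonneg _).trans_lt (hdd ⟨0, hn⟩)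
    exact pos_of_mul_pos_left h (abs_nonneg _)
  have hδ1 : δ < 1 := by
    -- the discriminant equals `(1 - m) ^ 2 + 16`
    have : 1 - m < √((5 - m) ^ 2 - 8 * (1 - m)) := Real.lt_sqrt_of_sq_lt (by nlinarith)
    linarith
  have hnear : ∀ z ∈ feasible n smax, NearDiagonal δ (fun i => K₀ i i * (1 - z i)⁻¹)
      (K₀ + Matrix.diagonal (rhoOf K₀ z)) := fun z hz => by
    simp only [← add_rhoOf]
    refine hdd.nearDiagonal hpsd hδ0.le hδ1 (rhoOf_nonneg (fun _ => hpsd.diag_nonneg) fun i => ?_)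
    have := (mem_feasible hsmax.le).1 hz i
    exact ⟨this.1, this.2.trans_lt hsmax1⟩
  have hpd : K₀.PosDef := by
    have := (hnear 0 (zero_mem_feasible hsmax.le)).posDef
    rw [rhoOf_zero] at this
    simpa using this
  obtain ⟨hlam, hdiag⟩ := minEigenvalue_pos_and_le_diag hpd
  set v := ‖y‖ ^ 2 / (minEigenvalue K₀ * (1 - δ) ^ 2) with hv
  have hδ' : 0 < 1 - δ := sub_pos.2 hδ1
  have hden : 0 < minEigenvalue K₀ * (1 - δ) ^ 2 := by positivity
  have hv0 : 0 ≤ v := by positivity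
  -- the bounds on `‖y‖` leave a factor of two in front of `v` to spare
  have hlower : m ≤ 2 * (1 + δ)⁻¹ - ((1 - δ) ^ 2)⁻¹ - 2 * (1 - (1 + δ)⁻¹) * v := by
    have e : 2 * (1 - (1 - δ) / (1 + δ)) = 4 * (1 - (1 + δ)⁻¹) := by field_simp; ring
    have hpos : 0 < 1 - (1 + δ)⁻¹ := sub_pos.2 (inv_lt_one_of_one_lt₀ (by linarith))
    have := (div_le_iff₀' hden).2 hconv
    rw [← hv, e, le_div_iff₀ (by positivity)] at this
    nlinarith
  have hupper : 1 + 2 * ((1 - δ)⁻¹ - 1) * v ≤ M * (1 - smax) ^ 2 := by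
    have e : 2 * ((1 + δ) / (1 - δ) - 1) = 4 * ((1 - δ)⁻¹ - 1) := by field_simp; ring
    have hpos : 0 < (1 - δ)⁻¹ - 1 := sub_pos.2 ((one_lt_inv₀ hδ').2 (by linarith))
    have := (div_le_iff₀' hden).2 hsmooth
    rw [← hv, e, le_div_iff₀ (by positivity)] at this
    nlinarith
  have hs0 : 0 < 1 - smax := sub_pos.2 hsmax1
  have hM1 : 1 < M := lt_of_le_of_lt
    ((one_le_div (by positivity)).2 (pow_le_one₀ hs0.le (by linarith))) hM
  have hm1 : m ≤ 1 := by
    have a1 : (1 + δ)⁻¹ ≤ 1 := inv_le_one_of_one_le₀ (by linarith)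
    have a2 : 1 ≤ ((1 - δ) ^ 2)⁻¹ :=
      (one_le_inv₀ (by positivity)).2 (pow_le_one₀ hδ'.le (by linarith))
    nlinarith
  have hinv : ∀ z ∈ feasible n smax, ∀ i, 1 ≤ (1 - z i)⁻¹ ∧ (1 - z i)⁻¹ ≤ (1 - smax)⁻¹ :=
    fun z hz i => by
      have := (mem_feasible hsmax.le).1 hz i
      exact ⟨(one_le_inv₀ (by linarith)).2 (by linarith),
        inv_anti₀ hs0 (by linarith)⟩
  have hdiff : ∀ s ∈ feasible n smax, DifferentiableAt ℝ F s := fun s hs =>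
    hF ▸ (logML_second_order hsmax.le hsmax1 hnear hs hs).1
  have hcont : ContinuousOn F (feasible n smax) := fun s hs =>
    (hdiff s hs).continuousAt.continuousWithinAt
  -- the curvature bounds hold for `-2 L`, so the constants for `L` are `m / 2` and `M / 2`
  have hconcave : ∀ s ∈ feasible n smax, ∀ t ∈ feasible n smax,
      F t ≤ F s + fderiv ℝ F s (t - s) - m / 2 / 2 * ∑ i, (t i - s i) ^ 2 := fun s hs t ht => by
    have h := (logML_second_order (y := y) hsmax.le hsmax1 hnear hs ht).2.1
      (m * ∑ i, (t i - s i) ^ 2) fun z hz => by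
        refine le_trans ?_ ((hnear z hz).secondVar_lower
          (sum_mul_weights_sq_le hsmax.le hsmax1 hlam hdiag hz (hnear z hz)) hlower _)
        refine mul_le_mul_of_nonneg_left (Finset.sum_le_sum fun i _ => ?_) hm.le
        rw [mul_pow]
        exact le_mul_of_one_le_right (sq_nonneg _) (one_le_pow₀ (hinv z hz i).1)
    rw [← hF] at h
    linarith
  have hsm : ∀ s ∈ feasible n smax, ∀ j, ∀ x, 0 ≤ x → x ≤ smax → s j = 0 →
      F s + x * fderiv ℝ F s (Pi.single j 1) - M / 2 / 2 * x ^ 2 ≤ F (s + Pi.single j x) := by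
    intro s hs j x hx0 hx1 hsj
    have ht : s + Pi.single j x ∈ feasible n smax := (mem_feasible hsmax.le).2 fun i => by
      by_cases hij : i = j
      · subst hij; simpa [hsj] using And.intro hx0 hx1
      · simpa [hij] using (mem_feasible hsmax.le).1 hs i
    have h := (logML_second_order (y := y) hsmax.le hsmax1 hnear hs ht).2.2
      (M * x ^ 2) fun z hz => by
        refine ((hnear z hz).secondVar_upper
          (sum_mul_weights_sq_le hsmax.le hsmax1 hlam hdiag hz (hnear z hz)) hupper j
          fun i hi => by simp [hi]).trans ?_
        have hz1 := hinv z hz j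
        have : (1 - smax) * (1 - z j)⁻¹ ≤ 1 :=
          (mul_le_mul_of_nonneg_left hz1.2 hs0.le).trans_eq (mul_inv_cancel₀ hs0.ne')
        have h2 := pow_le_one₀ (n := 2) (mul_nonneg hs0.le (zero_le_one.trans hz1.1)) this
        calc _ = M * x ^ 2 * ((1 - smax) * (1 - z j)⁻¹) ^ 2 := by
              simp; ring
          _ ≤ M * x ^ 2 * 1 := mul_le_mul_of_nonneg_left h2 (by positivity)
          _ = _ := mul_one _
    rw [← hF, add_sub_cancel_left] at h
    have e : (Pi.single j x : Fin n → ℝ) = x • Pi.single j 1 := by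
      rw [← Pi.single_smul, smul_eq_mul, mul_one]
    have e2 : fderiv ℝ F s (Pi.single j x) = x * fderiv ℝ F s (Pi.single j 1) := by
      rw [e, map_smul, smul_eq_mul]
    rw [e2] at h
    linarith
  obtain ⟨S, s, h, -⟩ := exists_OMP hsmax.le hcont r (by omega)
  refine ⟨⟨S, s, h⟩, exists_isSparseMax hsmax.le hcont r, fun S s hs => ?_, fun S s t hs ht => ?_⟩
  · exact sub_nonneg.2 (hs.2 0 (zero_mem_feasible hsmax.le) fun _ _ => rfl)
  · have := hs.approximation_guarantee hsmax.le (m := m / 2) (M := M / 2) (by positivity)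
      (by positivity) (by linarith) hdiff hconcave hsm ht
    rwa [div_div_div_cancel_right₀ two_ne_zero] at this
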